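/- Let $n\ge 1$ players $1,\dots,n$ have the same finite action set of size $m$, so that the mixed strategies of each player form the simplex $\Delta\subset\mathbb{R}^m$ and the pure strategies are the canonical vectors $A=\{e_1,\dots,e_m\}$. Let all players have the same utility function $u$, and let $u$ be permutation invariant (its value does not change when two players exchange their actions). Let $U$ be the multilinear extension $U(p_1,\dots,p_n)=\sum_y u(y)\,p_1(y_1)\cdots p_n(y_n)$ of $u$ to all $n$-tuples of vectors of $\mathbb{R}^m$. Let $C\subset\Delta^n$ be the set of consensus equilibria, that is, of the mixed-strategy Nash equilibria $(p_1,\dots,p_n)$ with $p_1=\cdots=p_n$. For $p\in(\mathbb{R}^m)^n$ put $d(p,C)=\inf_{p'\in C}\|p-p'\|$, where all norms are Euclidean. Let $G$ be a connected undirected communication graph on the players, let $\Omega_i$ be the set of neighbours of $i$, and let $W=(w_{ij})\in\mathbb{R}^{n\times n}$ be doubly stochastic, aperiodic and irreducible, with $w_{ij}=0$ whenever $i\neq j$ are not adjacent in $G$. A distributed ECFP (empirical centroid fictitious play) process consists of actions $a_i(t)\in A$ and estimates $\hat q_i(t)\in\mathbb{R}^m$, $t\ge1$, such that, with the empirical distributions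 $q_i(t)=\frac1t\sum_{s=1}^t a_i(s)$: the first actions $a_i(1)$ are arbitrary; $\hat q_i(1)=\sum_{j\in\Omega_i\cup\{i\}}w_{ij}\,q_j(1)$; and, for all $t\ge1$ and all $i$, the action $a_i(t+1)$ maximizes $U(\alpha_i,\hat q_i(t),\dots,\hat q_i(t))$ over $\alpha_i\in A$ (player $i$ plays $\alpha_i$ and every other player is assumed to play $\hat q_i(t)$; ties are broken arbitrarily), and $$\hat q_i(t+1)=\sum_{j\in\Omega_i\cup\{i\}}w_{ij}\bigl(\hat q_j(t)+q_j(t+1)-q_j(t)\bigr).$$ Then, for every distributed ECFP process, $C$ is non-empty and: 1. $d\bigl((\hat q_1(t),\dots,\hat q_n(t)),C\bigr)\to0$ as $t\to\infty$. 2. The estimates reach asymptotic consensus: $\|\hat q_i(t)-\hat q_j(t)\|\to0$ as $t\to\infty$ for all $i,j$. 3. The players achieve asymptotic strategy learning: $d\bigl((\hat q_i(t))^n,C\bigr)\to0$ as $t\to\infty$ for every $i$, where $(\hat q_i(t))^n=(\hat q_i(t),\dots,\hat q_i(t))$. 4. The estimates track the empirical centroid $\bar q(t)=\frac1n\sum_{j=1}^n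 q_j(t)$ with error $\|\hat q_i(t)-\bar q(t)\|=O\!\left(\frac{\log t}{t}\right)$ for every $i$. -/

import Mathlib

open Filter Topology

namespace ECFP

noncomputable section

/-- Joint strategies of the players in `N` over a common finite action set `Y`: tuples of vectors
in `ℝ^Y`, with the Euclidean norm on the whole tuple. -/
abbrev Joint (N Y : Type*) : Type _ := PiLp 2 (fun _ : N => EuclideanSpace ℝ Y)

/-- The pure strategy that puts probability one on the action `k`. -/
def pure {Y : Type*} [DecidableEq Y] (k : Y) : EuclideanSpace ℝ Y :=
  EuclideanSpace.single k 1

/-- The mixed utility of player `i`, the multilinear extension of the utility `u i` to all tuples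
of vectors in `ℝ^Y` (a tuple need not consist of probability vectors). -/
def mixedUtility {N Y : Type*} [Fintype N] [DecidableEq N] [Fintype Y]
    (u : N → (N → Y) → ℝ) (i : N) (p : N → EuclideanSpace ℝ Y) : ℝ :=
  ∑ y : N → Y, u i y * ∏ j, p j (y j)

/-- The utilities are identical and invariant under exchanging the actions of two players. -/
structure IsIdenticalPermInvariant {N Y : Type*} [DecidableEq N] (u : N → (N → Y) → ℝ) :
    Prop where
  identical : ∀ i j, u i = u j
  perm_invariant : ∀ (k i j : N) (y : N → Y), u k (y ∘ Equiv.swap i j) = u k y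

/-- The set of mixed-strategy Nash equilibria. -/
def nashEquilibria {N Y : Type*} [Fintype N] [DecidableEq N] [Fintype Y]
    (u : N → (N → Y) → ℝ) : Set (Joint N Y) :=
  {p | (∀ i, ⇑(p i) ∈ stdSimplex ℝ Y) ∧
    ∀ i, ∀ g : EuclideanSpace ℝ Y, ⇑g ∈ stdSimplex ℝ Y →
      mixedUtility u i (Function.update p.ofLp i g) ≤ mixedUtility u i p.ofLp}

/-- The set of consensus equilibria: Nash equilibria in which all players use the same strategy. -/
def consensusEquilibria {N Y : Type*} [Fintype N] [DecidableEq N] [Fintype Y]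
    (u : N → (N → Y) → ℝ) : Set (Joint N Y) :=
  {p | p ∈ nashEquilibria u ∧ ∀ i j, p i = p j}

/-- The empirical distribution of player `i` at time `t ≥ 1`; `a s i` is the action of player `i`
at time `s ≥ 1` (the value `a 0` is never used). -/
def empirical {N Y : Type*} [DecidableEq Y] (a : ℕ → N → Y) (t : ℕ) (i : N) :
    EuclideanSpace ℝ Y :=
  (t : ℝ)⁻¹ • ∑ s ∈ Finset.Icc 1 t, pure (a s i)

/-- The empirical centroid: the average over the players of the empirical distributions. -/
def centroid {N Y : Type*} [Fintype N] [DecidableEq Y] (a : ℕ → N → Y) (t : ℕ) :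
    EuclideanSpace ℝ Y :=
  (Fintype.card N : ℝ)⁻¹ • ∑ i, empirical a t i

/-- Aperiodicity of a square matrix: for every index `i`, the greatest common divisor of the return
times `k ≥ 1` with `(W ^ k) i i > 0` is one. -/
def IsAperiodic {N : Type*} [Fintype N] [DecidableEq N] (W : Matrix N N ℝ) : Prop :=
  ∀ i, ∀ d : ℕ, (∀ k : ℕ, 1 ≤ k → 0 < (W ^ k) i i → d ∣ k) → d = 1

/-- Admissible weight matrices for the communication graph `G`. -/
structure IsWeightMatrix {N : Type*} [Fintype N] [DecidableEq N] (G : SimpleGraph N)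
    (W : Matrix N N ℝ) : Prop where
  doublyStochastic : W ∈ doublyStochastic ℝ N
  aperiodic : IsAperiodic W
  irreducible : W.IsIrreducible
  sparsity : ∀ i j, i ≠ j → ¬ G.Adj i j → W i j = 0

/-- `a` and `qhat` are the actions and the centroid estimates (at times `t ≥ 1`) of a distributed
empirical centroid fictitious play. Player `i` uses only her own data and those of her neighbours;
ties between best responses are broken arbitrarily, and the first actions `a 1` are arbitrary. -/
structure IsDistributedECFP {N Y : Type*} [Fintype N] [DecidableEq N] [Fintype Y] [DecidableEq Y]
    (u : N → (N → Y) → ℝ) (G : SimpleGraph N) [DecidableRel G.Adj] (W : Matrix N N ℝ)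
    (a : ℕ → N → Y) (qhat : ℕ → N → EuclideanSpace ℝ Y) : Prop where
  init : ∀ i, qhat 1 i = ∑ j ∈ insert i (G.neighborFinset i), W i j • empirical a 1 j
  /-- The next action is a pure best response when all other players are assumed to use
  `qhat t i`. -/
  bestResponse : ∀ t, 1 ≤ t → ∀ i, ∀ k : Y,
    mixedUtility u i (Function.update (fun _ => qhat t i) i (pure k)) ≤
      mixedUtility u i (Function.update (fun _ => qhat t i) i (pure (a (t + 1) i)))
  update : ∀ t, 1 ≤ t → ∀ i, qhat (t + 1) i = ∑ j ∈ insert i (G.neighborFinset i),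
    W i j • (qhat t j + empirical a (t + 1) j - empirical a t j)

end

end ECFP

/-! Let `V x = U(x, …, x)`. Permutation invariance makes all partial derivatives on the diagonal
agree, so `DV(x) g = n · U(g, x, …, x)`. Hence a best response to `x` maximizes the linear
functional `DV(x)` over the simplex, and every stationary point of `V` there, repeated `n` times, is
a consensus equilibrium. The centroid moves with step `1 / (t + 1)` towards the average of the
chosen actions, so fictitious play is Frank-Wolfe ascent on `V` with directions computed at the
estimates instead of the centroid.

The estimates are within `O(1 / t)` of the centroid (`Matrix.exists_norm_sub_average_le`): some
power of `W` is entrywise positive and contracts disagreement, while the tracked distributions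
change by `O(1 / t)` per step. This inexactness costs only `O(1 / t²)` of ascent per step. As `V` is
bounded, step size times Frank-Wolfe gap is summable; the gap varies by a multiple of the step, so
it tends to zero (`exists_stationary_seq_of_inexact`). Compactness turns this into convergence to
the stationary set, and the estimates follow the centroid. -/

/-! ### Real sequences -/

/-- A nonnegative sequence that is summable against non-summable, square summable weights `γ`, and
whose increments are controlled by `γ`, tends to zero. -/
theorem tendsto_zero_of_summable_mul {γ v : ℕ → ℝ} (hγ : ∀ t, 0 ≤ γ t) (hγs : ¬ Summable γ)
    (hγ2 : Summable fun t => γ t ^ 2) (hv : ∀ t, 0 ≤ v t) (hs : Summable fun t => γ t * v t)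
    {C : ℝ} (hC : ∀ t, |v (t + 1) - v t| ≤ C * γ t) : Tendsto v atTop (𝓝 0) := by
  -- The increments of `v ^ 2` are summable, so `v` converges; a positive limit would make `γ`
  -- itself summable.
  have hd : ∀ t, dist (v t ^ 2) (v (t + 1) ^ 2) ≤ 2 * C * (γ t * v t) + C ^ 2 * γ t ^ 2 := by
    intro t
    have h1 := hC t
    have h2 : |v t + v (t + 1)| ≤ 2 * v t + C * γ t := by
      rw [abs_of_nonneg (add_nonneg (hv t) (hv _))]
      linarith [le_abs_self (v (t + 1) - v t)]
    calc dist (v t ^ 2) (v (t + 1) ^ 2) = |v (t + 1) - v t| * |v t + v (t + 1)| := by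
          rw [dist_comm, Real.dist_eq, ← abs_mul]; congr 1; ring
      _ ≤ (C * γ t) * (2 * v t + C * γ t) :=
          mul_le_mul h1 h2 (abs_nonneg _) ((abs_nonneg _).trans h1)
      _ = _ := by ring
  obtain ⟨l, hl⟩ := cauchySeq_tendsto_of_complete
    (cauchySeq_of_dist_le_of_summable _ hd ((hs.mul_left _).add (hγ2.mul_left _)))
  have hl0 : 0 ≤ l := ge_of_tendsto' hl fun t => sq_nonneg _
  have hvl : Tendsto v atTop (𝓝 (√l)) := by
    simpa [Function.comp_def, Real.sqrt_sq (hv _)] using (Real.continuous_sqrt.tendsto l).comp hl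
  rcases hl0.eq_or_lt with h0 | h0
  · simpa [← h0] using hvl
  · refine absurd ?_ hγs
    have hc : 0 < √l / 2 := by positivity
    have hev : ∀ᶠ t in atTop, √l / 2 < v t := hvl.eventually (lt_mem_nhds (by linarith))
    refine summable_of_isBigO_nat hs (Asymptotics.IsBigO.of_bound (√l / 2)⁻¹ ?_)
    filter_upwards [hev] with t ht
    rw [Real.norm_of_nonneg (hγ t), Real.norm_of_nonneg (mul_nonneg (hγ t) (hv t)),
      ← div_eq_inv_mul, le_div_iff₀ hc]
    exact mul_le_mul_of_nonneg_left ht.le (hγ t)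

/-- A perturbed contraction over `k` steps with perturbations of order `1 / t` decays as
`1 / t`. -/
theorem exists_le_div_of_contraction {M : ℕ → ℝ} {k : ℕ} (hk : 0 < k) {ρ D : ℝ} (hρ : 0 ≤ ρ)
    (hρ1 : ρ < 1) (hD : 0 ≤ D) (h : ∀ t, M (t + k) ≤ ρ * M t + D / (t + 1)) :
    ∃ B, ∀ t : ℕ, M t ≤ B / (t + 1) := by
  obtain ⟨T, hT⟩ := exists_nat_gt (2 * k / (1 - ρ) + k)
  have hρ' : 0 < 1 - ρ := by linarith
  obtain ⟨B₀, hB₀⟩ := ((Finset.range (T + k)).image fun t : ℕ => ((t : ℝ) + 1) * M t).bddAbove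
  -- The gap `(1 - ρ) * B * (s + 1)` is spent in two halves: `4 * D ≤ B * (1 - ρ)` pays for the
  -- perturbation, and `T`, through `hq`, pays for the shift by `k`.
  set B := max B₀ (max 0 (4 * D / (1 - ρ))) with hB
  have hBD : 4 * D ≤ B * (1 - ρ) := by
    rw [← div_le_iff₀ hρ']; exact (le_max_right _ _).trans (le_max_right _ _)
  have hB0 : 0 ≤ B := (le_max_left _ _).trans (le_max_right _ _)
  refine ⟨B, fun t => ?_⟩
  induction t using Nat.strong_induction_on with
  | _ t ih =>
    rcases lt_or_ge t (T + k) with ht | ht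
    · rw [le_div_iff₀ (by positivity), mul_comm]
      exact (hB₀ (Finset.mem_coe.2 (Finset.mem_image_of_mem _ (Finset.mem_range.2 ht)))).trans
        (le_max_left _ _)
    · obtain ⟨s, rfl⟩ := Nat.exists_eq_add_of_le' (show k ≤ t by omega)
      have hs : T ≤ s := by omega
      have hsR : (T : ℝ) ≤ s := by exact_mod_cast hs
      have hk0 : (0 : ℝ) ≤ k := Nat.cast_nonneg k
      have hq : 2 * (k : ℝ) ≤ (1 - ρ) * (s + 1) := by
        have : 2 * (k : ℝ) / (1 - ρ) ≤ s + 1 := by linarith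
        rw [div_le_iff₀ hρ'] at this; linarith
      have h1 := ih s (by omega)
      have h2 : M (s + k) ≤ (ρ * B + D) / (s + 1) := by
        refine (h s).trans ?_
        rw [add_div, mul_div_assoc]
        gcongr
      refine h2.trans ?_
      rw [div_le_div_iff₀ (by positivity) (by positivity)]
      push_cast
      have hks : (k : ℝ) ≤ s + 1 := by nlinarith
      nlinarith [mul_le_mul_of_nonneg_left hq hB0, mul_le_mul_of_nonneg_left hks hD,
        mul_le_mul_of_nonneg_right hBD (show (0:ℝ) ≤ s + 1 by positivity),
        mul_nonneg hB0 hk0, mul_nonneg (mul_nonneg hB0 hk0) hρ'.le]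

/-! ### Primitive matrices and dynamic average consensus -/

namespace Matrix
variable {N : Type*} [Fintype N] [DecidableEq N]

/-- The powers of an irreducible aperiodic matrix are eventually positive. -/
theorem IsIrreducible.exists_pow_pos_of_aperiodic {W : Matrix N N ℝ} (hW : W.IsIrreducible)
    (ha : ECFP.IsAperiodic W) : ∃ k : ℕ, 0 < k ∧ ∀ i j, 0 < (W ^ k) i j := by
  have hn : ∀ k i j, 0 ≤ (W ^ k) i j := fun k i j => pow_apply_nonneg hW.nonneg k i j
  have hmul : ∀ {k l i j m}, 0 < (W ^ k) i j → 0 < (W ^ l) j m → 0 < (W ^ (k + l)) i m := by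
    intro k l i j m h1 h2
    rw [pow_add, mul_apply]
    exact (mul_pos h1 h2).trans_le
      (Finset.single_le_sum (f := fun x => (W ^ k) i x * (W ^ l) x m)
        (fun x _ => mul_nonneg (hn k i x) (hn l x m)) (Finset.mem_univ j))
  have hret : ∀ i, ∃ K, ∀ m ≥ K, 0 < (W ^ m) i i := by
    intro i
    -- Return times form a submonoid of `ℕ` with gcd one, which contains all large integers.
    let S : AddSubmonoid ℕ :=
      { carrier := {k | 0 < (W ^ k) i i}
        zero_mem' := by simp
        add_mem' := fun h1 h2 => hmul h1 h2 }
    have hg : Nat.setGcd (S : Set ℕ) = 1 :=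
      ha i _ fun k _ hk => Nat.setGcd_dvd_of_mem (s := (S : Set ℕ)) hk
    obtain ⟨K, hK⟩ := Nat.exists_mem_closure_of_ge (S : Set ℕ)
    refine ⟨K, fun m hm => ?_⟩
    have := hK m hm (by simp [hg])
    rw [AddSubmonoid.closure_eq] at this
    exact this
  choose K hK using hret
  choose l _ hl using (isIrreducible_iff_exists_pow_pos hW.nonneg).1 hW
  -- One exponent serves all pairs: after reserving `l i j` steps from `i` to `j`, at least `K i`
  -- steps remain for a closed walk at `i`.
  refine ⟨1 + ∑ i, K i + ∑ i, ∑ j, l i j, by omega, fun i j => ?_⟩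
  have h1 : K i ≤ ∑ i, K i := Finset.single_le_sum (fun _ _ => Nat.zero_le _) (Finset.mem_univ i)
  have h2 : l i j ≤ ∑ i, ∑ j, l i j :=
    (Finset.single_le_sum (f := fun j => l i j) (fun _ _ => Nat.zero_le _)
      (Finset.mem_univ j)).trans (Finset.single_le_sum (f := fun i => ∑ j, l i j)
        (fun _ _ => Nat.zero_le _) (Finset.mem_univ i))
  have := hmul (hK i (1 + ∑ i, K i + ∑ i, ∑ j, l i j - l i j) (by omega)) (hl i j)
  rwa [Nat.sub_add_cancel (by omega)] at this

variable {E : Type*} [NormedAddCommGroup E] [NormedSpace ℝ E]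

theorem norm_sum_smul_le_of_doublyStochastic {W : Matrix N N ℝ} (hW : W ∈ doublyStochastic ℝ N)
    (i : N)
    {e : N → E} {c : ℝ} (hc : ∀ j, ‖e j‖ ≤ c) : ‖∑ j, W i j • e j‖ ≤ c := by
  calc ‖∑ j, W i j • e j‖ ≤ ∑ j, W i j * c := norm_sum_le_of_le _ fun j _ => by
        rw [norm_smul, Real.norm_of_nonneg (nonneg_of_mem_doublyStochastic hW)]
        exact mul_le_mul_of_nonneg_left (hc j) (nonneg_of_mem_doublyStochastic hW)
    _ = c := by rw [← Finset.sum_mul, sum_row_of_mem_doublyStochastic hW, one_mul]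

/-- A stochastic matrix with entries at least `η` contracts the vectors of sum zero. -/
theorem norm_sum_smul_le_of_sum_eq_zero {P : Matrix N N ℝ} (hP : P ∈ doublyStochastic ℝ N) {η : ℝ}
    (hη : ∀ i j, η ≤ P i j) {e : N → E} (he : ∑ j, e j = 0) {c : ℝ} (hc : ∀ j, ‖e j‖ ≤ c) (i : N) :
    ‖∑ j, P i j • e j‖ ≤ (1 - Fintype.card N * η) * c := by
  -- Since `e` sums to zero, `η` can be subtracted from every weight; the remaining weights are
  -- nonnegative with total `1 - n η`.
  have h1 : ∑ j, P i j • e j = ∑ j, (P i j - η) • e j := by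
    simp [sub_smul, ← Finset.smul_sum, he]
  calc ‖∑ j, P i j • e j‖ ≤ ∑ j, (P i j - η) * c := by
        rw [h1]
        refine norm_sum_le_of_le _ fun j _ => ?_
        rw [norm_smul, Real.norm_of_nonneg (sub_nonneg.2 (hη i j))]
        exact mul_le_mul_of_nonneg_left (hc j) (sub_nonneg.2 (hη i j))
    _ = _ := by
        rw [← Finset.sum_mul, Finset.sum_sub_distrib, sum_row_of_mem_doublyStochastic hP]; simp

/-- Dynamic average consensus: the estimates `z` track the average of slowly varying signals `r`. -/
theorem exists_norm_sub_average_le [Nonempty N] {W : Matrix N N ℝ} (hW : W ∈ doublyStochastic ℝ N)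
    {k : ℕ} (hk : 0 < k) (hpos : ∀ i j, 0 < (W ^ k) i j) {z r : ℕ → N → E} {D : ℝ}
    (hz0 : ∀ i, z 0 i = ∑ j, W i j • r 0 j)
    (hz : ∀ t i, z (t + 1) i = ∑ j, W i j • (z t j + r (t + 1) j - r t j))
    (hr : ∀ t i, ‖r (t + 1) i - r t i‖ ≤ D / (t + 1)) :
    ∃ B, ∀ (t : ℕ) (i : N), ‖z t i - (Fintype.card N : ℝ)⁻¹ • ∑ j, r t j‖ ≤ B / (t + 1) := by
  have hn : (Fintype.card N : ℝ) ≠ 0 := by simp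
  have hcol : ∀ f : N → E, ∑ i, ∑ j, W i j • f j = ∑ j, f j := fun f => by
    rw [Finset.sum_comm]
    simp [← Finset.sum_smul, sum_col_of_mem_doublyStochastic hW]
  have hrow : ∀ i (c : E), ∑ j, W i j • c = c := fun i c => by
    simp [← Finset.sum_smul, sum_row_of_mem_doublyStochastic hW]
  -- Unit column sums conserve the total, so the error `e` has sum zero and the contraction applies
  -- to it.
  have hsum : ∀ t, ∑ i, z t i = ∑ i, r t i := by
    intro t
    induction t with
    | zero => simp only [hz0, hcol]
    | succ t ih => simp only [hz, hcol, Finset.sum_sub_distrib, Finset.sum_add_distrib, ih]; abel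
  set m : ℕ → E := fun t => (Fintype.card N : ℝ)⁻¹ • ∑ j, r t j with hm
  set e : ℕ → N → E := fun t i => z t i - m t with he
  set δ : ℕ → N → E := fun t j => (r (t + 1) j - r t j) - (m (t + 1) - m t) with hδ
  have hD : 0 ≤ D := by
    obtain ⟨i⟩ := ‹Nonempty N›
    simpa using (norm_nonneg _).trans (hr 0 i)
  have hesum : ∀ t, ∑ i, e t i = 0 := fun t => by
    simp [he, hm, hsum, ← Nat.cast_smul_eq_nsmul ℝ, smul_smul, hn]
  have hestep : ∀ t i, e (t + 1) i = ∑ j, W i j • e t j + ∑ j, W i j • δ t j := by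
    intro t i
    rw [← Finset.sum_add_distrib]
    have : ∀ j, W i j • e t j + W i j • δ t j
        = W i j • (z t j + r (t + 1) j - r t j) - W i j • m (t + 1) := fun j => by
      simp only [he, hδ, smul_sub, smul_add]; abel
    rw [Finset.sum_congr rfl fun j _ => this j, Finset.sum_sub_distrib, hrow, ← hz]
  have hδn : ∀ t j, ‖δ t j‖ ≤ 2 * D / (t + 1) := by
    intro t j
    have h1 : ‖m (t + 1) - m t‖ ≤ D / (t + 1) := by
      have : m (t + 1) - m t = (Fintype.card N : ℝ)⁻¹ • ∑ j, (r (t + 1) j - r t j) := by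
        simp only [hm, Finset.sum_sub_distrib, smul_sub]
      rw [this, norm_smul, norm_inv, Real.norm_natCast, inv_mul_le_iff₀ (by positivity)]
      refine (norm_sum_le_of_le _ fun j _ => hr t j).trans_eq ?_
      simp
    refine (norm_sub_le _ _).trans ((add_le_add (hr t j) h1).trans_eq (by ring))
  -- Unrolling `l` steps gives `W ^ l` applied to the error plus `l` averaged perturbations, each at
  -- most `2 * D / (t + 1)`.
  have hiter : ∀ t l i, ‖e (t + l) i - ∑ j, (W ^ l) i j • e t j‖ ≤ l * (2 * D / (t + 1)) := by
    intro t l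
    induction l with
    | zero => intro i; simp [one_apply]
    | succ l ih =>
      intro i
      have h1 : e (t + (l + 1)) i - ∑ j, (W ^ (l + 1)) i j • e t j
          = ∑ j, W i j • (e (t + l) j - ∑ s, (W ^ l) j s • e t s)
            + ∑ j, W i j • δ (t + l) j := by
        rw [← add_assoc, hestep]
        have : ∑ j, (W ^ (l + 1)) i j • e t j = ∑ j, W i j • ∑ s, (W ^ l) j s • e t s := by
          simp only [pow_succ', mul_apply, Finset.sum_smul, Finset.smul_sum, smul_smul]
          exact Finset.sum_comm
        rw [this]
        simp only [smul_sub, Finset.sum_sub_distrib]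
        abel
      rw [h1]
      have h2 : ∀ j, ‖δ (t + l) j‖ ≤ 2 * D / (t + 1) := fun j => (hδn _ j).trans (by
        push_cast
        gcongr
        linarith [(Nat.cast_nonneg l : (0 : ℝ) ≤ l)])
      refine (norm_add_le _ _).trans ((add_le_add
        (norm_sum_smul_le_of_doublyStochastic hW i ih)
        (norm_sum_smul_le_of_doublyStochastic hW i h2)).trans_eq ?_)
      push_cast; ring
  have hPk : W ^ k ∈ doublyStochastic ℝ N := pow_mem hW k
  obtain ⟨p, hp⟩ := Finite.exists_min fun p : N × N => (W ^ k) p.1 p.2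
  set η := (W ^ k) p.1 p.2 with hη
  have hη0 : 0 < η := hpos _ _
  have hη1 : ∀ i j, η ≤ (W ^ k) i j := fun i j => hp (i, j)
  have hnη : Fintype.card N * η ≤ 1 := by
    obtain ⟨i⟩ := ‹Nonempty N›
    rw [← sum_row_of_mem_doublyStochastic hPk i]
    simpa using Finset.card_nsmul_le_sum Finset.univ (fun j => (W ^ k) i j) η fun j _ => hη1 i j
  have hcontr : ∀ t, ‖e (t + k)‖ ≤ (1 - Fintype.card N * η) * ‖e t‖ + (2 * k * D) / (t + 1) := by
    intro t
    refine (pi_norm_le_iff_of_nonempty _).2 fun i => ?_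
    have h1 := hiter t k i
    have h2 := norm_sum_smul_le_of_sum_eq_zero hPk hη1 (hesum t) (fun j => norm_le_pi_norm (e t) j) i
    have h3 := norm_sub_norm_le (e (t + k) i) (∑ j, (W ^ k) i j • e t j)
    have h4 : (k : ℝ) * (2 * D / (t + 1)) = (2 * k * D) / (t + 1) := by ring
    linarith
  obtain ⟨B, hB⟩ := exists_le_div_of_contraction (M := fun t => ‖e t‖) hk (by linarith)
    (by have : (0:ℝ) < Fintype.card N * η := by positivity
        linarith) (by positivity) hcontr
  exact ⟨B, fun t i => (norm_le_pi_norm (e t) i).trans (hB t)⟩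

end Matrix

/-! ### Inexact Frank-Wolfe ascent -/

section FrankWolfe
variable {E : Type*} [NormedAddCommGroup E] [NormedSpace ℝ E]

/-- The stationary points of the maximization of `V` over `K`. -/
def stationaryPoints (V : E → ℝ) (K : Set E) : Set E :=
  {x | x ∈ K ∧ ∀ g ∈ K, fderiv ℝ V x (g - x) ≤ 0}

/-- If a nonnegative continuous function tends to zero along a sequence in a compact set, the
sequence approaches the zero set of the function. -/
theorem IsCompact.exists_zero_seq_tendsto_dist {E : Type*} [PseudoMetricSpace E] {K : Set E} (hK : IsCompact K) {v : E → ℝ}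
    (hv : ContinuousOn v K) (hv0 : ∀ x ∈ K, 0 ≤ v x) {x : ℕ → E} (hx : ∀ t, x t ∈ K)
    (h : Tendsto (fun t => v (x t)) atTop (𝓝 0)) :
    ∃ z : ℕ → E, (∀ t, z t ∈ K ∧ v (z t) = 0) ∧
      Tendsto (fun t => dist (x t) (z t)) atTop (𝓝 0) := by
  set Z : Set E := {z | z ∈ K ∧ v z = 0} with hZ
  have hne : Z.Nonempty := by
    obtain ⟨z, hz, hmin⟩ := hK.exists_isMinOn ⟨_, hx 0⟩ hv
    exact ⟨z, hz, le_antisymm (ge_of_tendsto' h fun t => hmin (hx t)) (hv0 z hz)⟩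
  have hinf : Tendsto (fun t => Metric.infDist (x t) Z) atTop (𝓝 0) := by
    refine tendsto_order.2 ⟨fun a ha => Eventually.of_forall fun t =>
      ha.trans_le Metric.infDist_nonneg, fun ε hε => ?_⟩
    -- On the compact part of `K` at distance at least `ε` from the zeros, `v` has a positive
    -- minimum, which `v (x t)` eventually undercuts.
    set S : Set E := K ∩ {y | ε ≤ Metric.infDist y Z} with hS
    have hSc : IsCompact S :=
      hK.inter_right (isClosed_le continuous_const (Metric.continuous_infDist_pt Z))
    rcases S.eq_empty_or_nonempty with hSe | hSn
    · refine Eventually.of_forall fun t => not_le.1 fun hle => ?_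
      have : x t ∈ S := ⟨hx t, hle⟩
      simp [hSe] at this
    · obtain ⟨y, hy, hmin⟩ := hSc.exists_isMinOn hSn (hv.mono Set.inter_subset_left)
      have hvy : 0 < v y := (hv0 y hy.1).lt_of_ne fun h0 => by
        have h1 : Metric.infDist y Z = 0 := Metric.infDist_zero_of_mem ⟨hy.1, h0.symm⟩
        have h2 : ε ≤ Metric.infDist y Z := hy.2
        linarith
      filter_upwards [h.eventually (gt_mem_nhds hvy)] with t ht
      exact not_le.1 fun hle => absurd (hmin (⟨hx t, hle⟩ : x t ∈ S)) (not_le.2 ht)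
  have hex : ∀ t : ℕ, ∃ z ∈ Z, dist (x t) z < Metric.infDist (x t) Z + 1 / ((t : ℝ) + 1) :=
    fun t => (Metric.infDist_lt_iff hne).1 (lt_add_of_pos_right _ (by positivity))
  choose z hz hzd using hex
  refine ⟨z, hz, squeeze_zero (fun _ => dist_nonneg) (fun t => (hzd t).le) ?_⟩
  simpa using hinf.add (tendsto_one_div_add_atTop_nhds_zero_nat (𝕜 := ℝ))

theorem exists_lipschitzOn_fderiv {V : E → ℝ} (hV : ContDiff ℝ 2 V) {K : Set E}
    (hK : IsCompact K) :
    ∃ L : ℝ, 0 ≤ L ∧ ∀ x ∈ K, ∀ y ∈ K, ‖fderiv ℝ V x - fderiv ℝ V y‖ ≤ L * ‖x - y‖ := by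
  have h1 : ContDiff ℝ 1 (fderiv ℝ V) := hV.fderiv_right (by norm_num)
  obtain ⟨L, hL⟩ := h1.locallyLipschitz.locallyLipschitzOn.exists_lipschitzOnWith_of_compact hK
  exact ⟨L, L.2, fun x hx y hy => by simpa [dist_eq_norm] using hL.dist_le_mul x hx y hy⟩

/-- Inexact Frank-Wolfe ascent with square summable, non-summable step sizes converges to the set
of stationary points. -/
theorem exists_stationary_seq_of_inexact {K : Set E} (hK : IsCompact K) (hc : Convex ℝ K)
    {V : E → ℝ} (hV : ContDiff ℝ 2 V) {γ : ℕ → ℝ} (hγ : ∀ t, 0 ≤ γ t)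
    (hγs : ¬ Summable γ) (hγ2 : Summable fun t => γ t ^ 2) {x b : ℕ → E} (hx : ∀ t, x t ∈ K)
    (hb : ∀ t, b t ∈ K) (hstep : ∀ t, x (t + 1) = x t + γ t • (b t - x t)) {c : ℝ}
    (hbest : ∀ t, ∀ g ∈ K, fderiv ℝ V (x t) g ≤ fderiv ℝ V (x t) (b t) + c * γ t) :
    ∃ z : ℕ → E, (∀ t, z t ∈ stationaryPoints V K) ∧
      Tendsto (fun t => dist (x t) (z t)) atTop (𝓝 0) := by
  obtain ⟨L, hL0, hL⟩ := exists_lipschitzOn_fderiv hV hK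
  have hdiff : Differentiable ℝ V := hV.differentiable (by norm_num)
  have hVc : Continuous (fderiv ℝ V) := hV.continuous_fderiv (by norm_num)
  obtain ⟨M, hM⟩ := hK.exists_bound_of_continuousOn hVc.continuousOn
  obtain ⟨M', hM'⟩ := hK.exists_bound_of_continuousOn hV.continuous.continuousOn
  obtain ⟨R, hR⟩ := Metric.isBounded_iff.1 hK.isBounded
  have hR' : ∀ y ∈ K, ∀ z ∈ K, ‖y - z‖ ≤ R := fun y hy z hz => by
    simpa [dist_eq_norm] using hR hy hz
  have hR0 : 0 ≤ R := (norm_nonneg _).trans (hR' _ (hx 0) _ (hx 0))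
  have hmax : ∀ y : E, ∃ g ∈ K, ∀ g' ∈ K, fderiv ℝ V y g' ≤ fderiv ℝ V y g := fun y =>
    hK.exists_isMaxOn ⟨_, hx 0⟩ (fderiv ℝ V y).continuous.continuousOn
  choose g hgK hg using hmax
  -- The Frank-Wolfe gap: on `K` it is nonnegative and vanishes exactly at the stationary points.
  set v : E → ℝ := fun y => fderiv ℝ V y (g y - y) with hv
  have hv0 : ∀ y ∈ K, 0 ≤ v y := fun y hy => by
    simp only [hv, map_sub]; linarith [hg y y hy]
  -- The maximizer `g y` is a competitor at `z`, so no continuity of `g` is needed.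
  have hvle : ∀ y ∈ K, ∀ z ∈ K, v y - v z ≤ (L * R + M) * ‖y - z‖ := by
    intro y hy z hz
    have h1 := hg z (g y) (hgK y)
    have h2 : (fderiv ℝ V y - fderiv ℝ V z) (g y - y) ≤ L * ‖y - z‖ * R :=
      (le_abs_self _).trans (((fderiv ℝ V y - fderiv ℝ V z).le_opNorm _).trans
        (mul_le_mul (hL y hy z hz) (hR' _ (hgK y) _ hy) (norm_nonneg _) (by positivity)))
    have h3 : fderiv ℝ V z (z - y) ≤ M * ‖y - z‖ :=
      (le_abs_self _).trans (((fderiv ℝ V z).le_opNorm _).trans (by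
        rw [norm_sub_rev]; exact mul_le_mul_of_nonneg_right (hM z hz) (norm_nonneg _)))
    simp only [hv, map_sub, sub_apply] at h1 h2 h3 ⊢
    linarith
  have hC0 : 0 ≤ L * R + M := by
    have := (norm_nonneg _).trans (hM _ (hx 0))
    positivity
  have hvabs : ∀ y ∈ K, ∀ z ∈ K, |v y - v z| ≤ (L * R + M) * ‖y - z‖ := fun y hy z hz => by
    refine abs_sub_le_iff.2 ⟨hvle y hy z hz, ?_⟩
    rw [norm_sub_rev]; exact hvle z hz y hy
  have hvc : ContinuousOn v K :=
    (LipschitzOnWith.of_dist_le_mul (K := ⟨L * R + M, hC0⟩) fun y hy z hz => by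
      rw [Real.dist_eq, dist_eq_norm]; exact hvabs y hy z hz).continuousOn
  have hstepn : ∀ t, ‖x (t + 1) - x t‖ ≤ R * γ t := fun t => by
    rw [hstep, add_sub_cancel_left, norm_smul, Real.norm_of_nonneg (hγ t), mul_comm]
    exact mul_le_mul_of_nonneg_right (hR' _ (hb t) _ (hx t)) (hγ t)
  have hascent : ∀ t, γ t * v (x t) ≤
      V (x (t + 1)) - V (x t) + (c + L * R ^ 2) * γ t ^ 2 := by
    intro t
    set s := segment ℝ (x t) (x (t + 1)) with hs
    have hsK : s ⊆ K := hc.segment_subset (hx t) (hx _)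
    -- Along the segment the derivative varies by at most `L * R * γ t`, so linearization errs by at
    -- most `L * R ^ 2 * γ t ^ 2`.
    have hmv := Convex.norm_image_sub_le_of_norm_hasFDerivWithin_le' (f := V) (s := s)
      (φ := fderiv ℝ V (x t)) (C := L * (R * γ t))
      (fun y _ => (hdiff y).hasFDerivAt.hasFDerivWithinAt)
      (fun y hy => (hL y (hsK hy) _ (hx t)).trans (mul_le_mul_of_nonneg_left
        ((norm_sub_le_of_mem_segment hy).trans (hstepn t)) hL0))
      (convex_segment _ _) (left_mem_segment _ _ _) (right_mem_segment _ _ _)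
    have h1 : ‖V (x (t + 1)) - V (x t) - fderiv ℝ V (x t) (x (t + 1) - x t)‖
        ≤ L * (R * γ t) * (R * γ t) :=
      hmv.trans (mul_le_mul_of_nonneg_left (hstepn t) (by have := hγ t; positivity))
    have h2 := neg_le_of_abs_le h1
    have h3 : fderiv ℝ V (x t) (x (t + 1) - x t)
        = γ t * (fderiv ℝ V (x t) (b t) - fderiv ℝ V (x t) (x t)) := by
      rw [hstep, add_sub_cancel_left, map_smul, map_sub, smul_eq_mul]
    have h4 : v (x t) ≤ fderiv ℝ V (x t) (b t) - fderiv ℝ V (x t) (x t) + c * γ t := by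
      simp only [hv, map_sub]
      linarith [hbest t _ (hgK (x t))]
    have h5 := mul_le_mul_of_nonneg_left h4 (hγ t)
    rw [h3] at h2
    linarith
  have hsummable : Summable fun t => γ t * v (x t) := by
    refine summable_of_sum_range_le (c := 2 * M' + |c + L * R ^ 2| * ∑' t, γ t ^ 2)
      (fun t => mul_nonneg (hγ t) (hv0 _ (hx t))) fun n => ?_
    calc ∑ t ∈ Finset.range n, γ t * v (x t)
        ≤ ∑ t ∈ Finset.range n, (V (x (t + 1)) - V (x t) + |c + L * R ^ 2| * γ t ^ 2) :=
          Finset.sum_le_sum fun t _ => (hascent t).trans (by gcongr; exact le_abs_self _)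
      _ = V (x n) - V (x 0) + |c + L * R ^ 2| * ∑ t ∈ Finset.range n, γ t ^ 2 := by
          rw [Finset.sum_add_distrib, Finset.sum_range_sub (fun t => V (x t)), Finset.mul_sum]
      _ ≤ _ := by
          have h1 := le_of_abs_le (hM' _ (hx n))
          have h2 := neg_le_of_abs_le (hM' _ (hx 0))
          have h3 := hγ2.sum_le_tsum (Finset.range n) fun t _ => sq_nonneg (γ t)
          have h4 := mul_le_mul_of_nonneg_left h3 (abs_nonneg (c + L * R ^ 2))
          linarith
  have hlim : Tendsto (fun t => v (x t)) atTop (𝓝 0) :=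
    tendsto_zero_of_summable_mul hγ hγs hγ2 (fun t => hv0 _ (hx t)) hsummable
      (C := (L * R + M) * R) fun t => (hvabs _ (hx _) _ (hx t)).trans
        ((mul_le_mul_of_nonneg_left (hstepn t) hC0).trans_eq (by ring))
  obtain ⟨z, hz, hzt⟩ := hK.exists_zero_seq_tendsto_dist hvc hv0 hx hlim
  refine ⟨z, fun t => ⟨(hz t).1, fun g' hg' => ?_⟩, hzt⟩
  have h1 := hg (z t) g' hg'
  have h2 := (hz t).2
  simp only [hv, map_sub] at h2 ⊢
  linarith

/-- Frank-Wolfe ascent in which the direction is the average of best directions computed by several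
agents at perturbed base points. -/
theorem exists_stationary_seq_of_average [FiniteDimensional ℝ E] {N : Type*} [Fintype N]
    [Nonempty N] {K : Set E} (hK : IsCompact K)
    (hc : Convex ℝ K) {V : E → ℝ} (hV : ContDiff ℝ 2 V) {γ : ℕ → ℝ} (hγ : ∀ t, 0 ≤ γ t)
    (hγ1 : ∀ t, γ t ≤ 1) (hγs : ¬ Summable γ) (hγ2 : Summable fun t => γ t ^ 2) {x : ℕ → E}
    {β q : ℕ → N → E} (hx : ∀ t, x t ∈ K) (hβ : ∀ t i, β t i ∈ K)
    (hstep : ∀ t, x (t + 1) = x t + γ t • ((Fintype.card N : ℝ)⁻¹ • ∑ i, β t i - x t))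
    (hbest : ∀ t i, ∀ g ∈ K, fderiv ℝ V (q t i) g ≤ fderiv ℝ V (q t i) (β t i)) {c : ℝ}
    (hq : ∀ t i, ‖q t i - x t‖ ≤ c * γ t) :
    ∃ z : ℕ → E, (∀ t, z t ∈ stationaryPoints V K) ∧
      Tendsto (fun t => dist (x t) (z t)) atTop (𝓝 0) := by
  have hn : (0 : ℝ) < Fintype.card N := by positivity
  obtain ⟨R, hR⟩ := Metric.isBounded_iff.1 hK.isBounded
  have hR' : ∀ y ∈ K, ∀ z ∈ K, ‖y - z‖ ≤ R := fun y hy z hz => by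
    simpa [dist_eq_norm] using hR hy hz
  -- The base points `q t i` may leave `K`, but stay in its closed `|c|`-thickening, compact in
  -- finite dimension.
  obtain ⟨L, hL0, hL⟩ := exists_lipschitzOn_fderiv hV (hK.cthickening (r := |c|))
  have hqK : ∀ t i, q t i ∈ Metric.cthickening |c| K := fun t i =>
    Metric.mem_cthickening_of_dist_le _ _ _ _ (hx t) <| by
      rw [dist_eq_norm]
      refine (hq t i).trans ?_
      calc c * γ t ≤ |c| * 1 :=
            mul_le_mul (le_abs_self c) (hγ1 t) (hγ t) (abs_nonneg c)
        _ = |c| := mul_one _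
  have hxK : ∀ t, x t ∈ Metric.cthickening |c| K := fun t =>
    Metric.self_subset_cthickening _ (hx t)
  refine exists_stationary_seq_of_inexact hK hc hV hγ hγs hγ2 hx (fun t => ?_) hstep
    (c := L * c * R) fun t g hg => ?_
  · rw [Finset.smul_sum]
    exact hc.sum_mem (fun _ _ => by positivity) (by simp) fun i _ => hβ t i
  -- Moving the base point from `q t i` to `x t` costs `L * (c * γ t) * R`; the bound then survives
  -- averaging over agents.
  · have h1 : ∀ i, fderiv ℝ V (x t) g - L * c * R * γ t ≤ fderiv ℝ V (x t) (β t i) := fun i => by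
      have h2 : (fderiv ℝ V (x t) - fderiv ℝ V (q t i)) (g - β t i) ≤ L * (c * γ t) * R :=
        (le_abs_self _).trans (((fderiv ℝ V (x t) - fderiv ℝ V (q t i)).le_opNorm _).trans
          (mul_le_mul ((hL _ (hxK t) _ (hqK t i)).trans (by
            rw [norm_sub_rev]; exact mul_le_mul_of_nonneg_left (hq t i) hL0))
            (hR' _ hg _ (hβ t i)) (norm_nonneg _)
            (mul_nonneg hL0 ((norm_nonneg _).trans (hq t i)))))
      have h3 := hbest t i g hg
      simp only [map_sub, sub_apply] at h2
      linarith
    have h4 := Finset.card_nsmul_le_sum Finset.univ _ _ fun i _ => h1 i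
    rw [Finset.card_univ, nsmul_eq_mul] at h4
    rw [map_smul, map_sum, smul_eq_mul, ← sub_le_iff_le_add, le_inv_mul_iff₀ hn]
    exact h4

end FrankWolfe

namespace ECFP

/-! ### The simplex and its vertices -/

section Simplex
variable {Y : Type*} [Fintype Y]

/-- The mixed strategies of one player, as a subset of Euclidean space. -/
def simplex (Y : Type*) [Fintype Y] : Set (EuclideanSpace ℝ Y) := {x | ⇑x ∈ stdSimplex ℝ Y}

theorem simplex_eq_preimage :
    simplex Y = (EuclideanSpace.equiv Y ℝ) ⁻¹' stdSimplex ℝ Y := rfl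

theorem isCompact_simplex : IsCompact (simplex Y) := by
  rw [simplex_eq_preimage]
  exact (EuclideanSpace.equiv Y ℝ).toHomeomorph.isCompact_preimage.2 (isCompact_stdSimplex ℝ Y)

theorem convex_simplex : Convex ℝ (simplex Y) := by
  rw [simplex_eq_preimage]
  exact (convex_stdSimplex ℝ Y).linear_preimage (EuclideanSpace.equiv Y ℝ).toLinearMap

variable [DecidableEq Y]

theorem pure_mem_simplex (k : Y) : pure k ∈ simplex Y := by
  have := single_mem_stdSimplex ℝ k
  simpa [simplex, pure] using this

theorem eq_sum_smul_pure (g : EuclideanSpace ℝ Y) : g = ∑ k, g k • pure k := by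
  ext k
  simp [pure, Pi.single_apply]

/-- A linear functional on the simplex is a weighted average of its vertex values; thus pure best
responses are optimal among all mixed strategies. -/
theorem le_of_pure_le {φ : EuclideanSpace ℝ Y →L[ℝ] ℝ} {c : ℝ} (h : ∀ k, φ (pure k) ≤ c)
    {g : EuclideanSpace ℝ Y} (hg : g ∈ simplex Y) : φ g ≤ c := by
  rw [eq_sum_smul_pure g, map_sum]
  calc ∑ k, φ (g k • pure k) ≤ ∑ k, g k * c := Finset.sum_le_sum fun k _ => by
        rw [map_smul, smul_eq_mul]
        exact mul_le_mul_of_nonneg_left (h k) (hg.1 k)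
    _ = c := by rw [← Finset.sum_mul, hg.2, one_mul]

end Simplex

/-! ### The diagonal utility as a potential -/

section Utility
variable {N Y : Type*} [Fintype N] [DecidableEq N] [Fintype Y]

/-- Exchanging `i` and `j` in both the action profiles and the factors of the product carries one
deviation to the other. -/
theorem mixedUtility_update_const_eq {u : N → (N → Y) → ℝ} (hu : IsIdenticalPermInvariant u)
    (i j : N) (x g : EuclideanSpace ℝ Y) :
    mixedUtility u i (Function.update (fun _ => x) i g)
      = mixedUtility u j (Function.update (fun _ => x) j g) := by
  unfold mixedUtility
  rw [hu.identical i j, ← Equiv.sum_comp ((Equiv.swap i j).arrowCongr (Equiv.refl Y))]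
  refine Finset.sum_congr rfl fun y _ => ?_
  have h1 : (Equiv.swap i j).arrowCongr (Equiv.refl Y) y = y ∘ Equiv.swap i j := by
    ext l; simp [Equiv.arrowCongr]
  rw [h1, hu.perm_invariant, ← Equiv.prod_comp (Equiv.swap i j)]
  congr 1
  refine Finset.prod_congr rfl fun l _ => ?_
  have h2 : Function.update (fun _ => x) i g (Equiv.swap i j l)
      = Function.update (fun _ => x) j g l := by
    simp only [Function.update_apply, Equiv.swap_apply_eq_iff, Equiv.swap_apply_left]
  simp [h2]

/-- The mixed utility as a continuous multilinear map. -/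
noncomputable def mixedUtilityMultilinear (u : N → (N → Y) → ℝ) (i : N) :
    ContinuousMultilinearMap ℝ (fun _ : N => EuclideanSpace ℝ Y) ℝ :=
  ∑ y : N → Y, u i y • (ContinuousMultilinearMap.mkPiAlgebra ℝ N ℝ).compContinuousLinearMap
    fun j => EuclideanSpace.proj (y j)

theorem mixedUtilityMultilinear_apply (u : N → (N → Y) → ℝ) (i : N)
    (p : N → EuclideanSpace ℝ Y) : mixedUtilityMultilinear u i p = mixedUtility u i p := by
  simp [mixedUtilityMultilinear, mixedUtility]

/-- The mixed utility of player `i` when all players use the same strategy. -/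
noncomputable def diagonalUtility (u : N → (N → Y) → ℝ) (i : N) (x : EuclideanSpace ℝ Y) : ℝ :=
  mixedUtility u i fun _ => x

theorem diagonalUtility_eq_comp (u : N → (N → Y) → ℝ) (i : N) :
    diagonalUtility u i = mixedUtilityMultilinear u i ∘
      ContinuousLinearMap.pi fun _ : N => ContinuousLinearMap.id ℝ (EuclideanSpace ℝ Y) := by
  ext x
  simp only [diagonalUtility, Function.comp_apply, mixedUtilityMultilinear_apply]
  rfl

theorem contDiff_diagonalUtility (u : N → (N → Y) → ℝ) (i : N) :
    ContDiff ℝ 2 (diagonalUtility u i) := by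
  rw [diagonalUtility_eq_comp]
  exact (mixedUtilityMultilinear u i).contDiff.comp (ContinuousLinearMap.contDiff _)

/-- In a permutation invariant game with identical utilities, all unilateral deviations from a
consensus strategy contribute equally to the derivative of the diagonal utility. -/
theorem fderiv_diagonalUtility {u : N → (N → Y) → ℝ} (hu : IsIdenticalPermInvariant u)
    (i j : N) (x g : EuclideanSpace ℝ Y) :
    fderiv ℝ (diagonalUtility u i) x g
      = Fintype.card N * mixedUtility u j (Function.update (fun _ => x) j g) := by
  have h := ((mixedUtilityMultilinear u i).hasFDerivAt fun _ => x).comp x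
    (ContinuousLinearMap.pi fun _ : N =>
      ContinuousLinearMap.id ℝ (EuclideanSpace ℝ Y)).hasFDerivAt
  rw [diagonalUtility_eq_comp, h.fderiv]
  simp only [ContinuousLinearMap.comp_apply, ContinuousMultilinearMap.linearDeriv_apply,
    mixedUtilityMultilinear_apply]
  rw [← nsmul_eq_mul, ← Finset.card_univ, ← Finset.sum_const]
  refine Finset.sum_congr rfl fun l _ => ?_
  rw [mixedUtility_update_const_eq hu j l, mixedUtility, mixedUtility, hu.identical i l]
  rfl

/-- By the derivative formula, stationarity says that no unilateral deviation from the constant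
profile pays. -/
theorem toLp_const_mem_consensusEquilibria {u : N → (N → Y) → ℝ} (hu : IsIdenticalPermInvariant u)
    (i : N) {z : EuclideanSpace ℝ Y} (hz : z ∈ stationaryPoints (diagonalUtility u i) (simplex Y)) :
    (WithLp.toLp 2 (fun _ : N => z) : Joint N Y) ∈ consensusEquilibria u := by
  refine ⟨⟨fun _ => hz.1, fun j g hg => ?_⟩, fun _ _ => rfl⟩
  have h1 := hz.2 g hg
  rw [map_sub, fderiv_diagonalUtility hu i j, fderiv_diagonalUtility hu i j, ← mul_sub,
    Function.update_eq_self j (fun _ : N => z)] at h1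
  have hn : (0 : ℝ) < Fintype.card N := by
    have : Nonempty N := ⟨i⟩
    positivity
  exact sub_nonpos.1 (nonpos_of_mul_nonpos_right h1 hn)

theorem tendsto_infDist_consensusEquilibria {ι : Type*} {l : Filter ι} {u : N → (N → Y) → ℝ}
    (hu : IsIdenticalPermInvariant u) (i₀ : N) {p : ι → N → EuclideanSpace ℝ Y}
    {z : ι → EuclideanSpace ℝ Y}
    (hz : ∀ t, z t ∈ stationaryPoints (diagonalUtility u i₀) (simplex Y))
    (hp : ∀ i, Tendsto (fun t => p t i - z t) l (𝓝 0)) :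
    Tendsto (fun t => Metric.infDist (WithLp.toLp 2 (p t) : Joint N Y) (consensusEquilibria u)) l
      (𝓝 0) := by
  have h1 : Tendsto (fun t => (WithLp.toLp 2 fun i => p t i - z t : Joint N Y)) l (𝓝 0) :=
    ((PiLp.continuous_toLp 2 fun _ : N => EuclideanSpace ℝ Y).tendsto 0).comp
      (tendsto_pi_nhds.2 hp)
  refine squeeze_zero (fun _ => Metric.infDist_nonneg) (fun t =>
    (Metric.infDist_le_dist_of_mem (toLp_const_mem_consensusEquilibria hu i₀ (hz t))).trans_eq ?_)
    (tendsto_zero_iff_norm_tendsto_zero.1 h1)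
  rw [dist_eq_norm]
  rfl

end Utility

/-! ### Recursions for empirical distributions -/

section Empirical
variable {N Y : Type*} [DecidableEq Y]

theorem empirical_mem_simplex [Fintype Y] (a : ℕ → N → Y) {t : ℕ} (ht : 1 ≤ t) (i : N) :
    empirical a t i ∈ simplex Y := by
  have : (t : ℝ) ≠ 0 := by positivity
  rw [empirical, Finset.smul_sum]
  exact convex_simplex.sum_mem (fun _ _ => by positivity) (by simp [this])
    fun _ _ => pure_mem_simplex _

theorem centroid_mem_simplex [Fintype N] [Fintype Y] [Nonempty N] (a : ℕ → N → Y) {t : ℕ} (ht : 1 ≤ t) :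
    centroid a t ∈ simplex Y := by
  rw [centroid, Finset.smul_sum]
  exact convex_simplex.sum_mem (fun _ _ => by positivity) (by simp)
    fun i _ => empirical_mem_simplex a ht i

theorem empirical_succ (a : ℕ → N → Y) (t : ℕ) (i : N) :
    empirical a (t + 1) i
      = empirical a t i + ((t : ℝ) + 1)⁻¹ • (pure (a (t + 1) i) - empirical a t i) := by
  rcases Nat.eq_zero_or_pos t with rfl | ht
  · simp [empirical]
  · have h0 : (t : ℝ) ≠ 0 := by positivity
    have h1 : (t : ℝ) + 1 ≠ 0 := by positivity
    simp only [empirical]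
    rw [Finset.sum_Icc_succ_top (by omega)]
    push_cast
    match_scalars <;> field_simp
    ring

/-- This is the Frank-Wolfe step of size `1 / (t + 1)`. -/
theorem centroid_succ [Fintype N] (a : ℕ → N → Y) (t : ℕ) :
    centroid a (t + 1) = centroid a t + ((t : ℝ) + 1)⁻¹ •
      ((Fintype.card N : ℝ)⁻¹ • ∑ i, pure (a (t + 1) i) - centroid a t) := by
  simp only [centroid, empirical_succ, Finset.sum_add_distrib, ← Finset.smul_sum,
    Finset.sum_sub_distrib]
  module

theorem norm_pure [Fintype Y] (k : Y) : ‖pure k‖ = 1 := by simp [pure]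

theorem norm_empirical_le [Fintype Y] (a : ℕ → N → Y) (t : ℕ) (i : N) : ‖empirical a t i‖ ≤ 1 := by
  rw [empirical, norm_smul, norm_inv, Real.norm_natCast]
  refine (mul_le_mul_of_nonneg_left (norm_sum_le_of_le _ fun s _ => (norm_pure _).le)
    (by positivity)).trans ?_
  simpa using inv_mul_le_one (a := (t : ℝ))

theorem norm_empirical_succ_sub_le [Fintype Y] (a : ℕ → N → Y) (t : ℕ) (i : N) :
    ‖empirical a (t + 1) i - empirical a t i‖ ≤ 2 / (t + 1) := by
  rw [empirical_succ, add_sub_cancel_left, norm_smul, norm_inv,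
    Real.norm_of_nonneg (by positivity), inv_mul_eq_div]
  gcongr
  refine (norm_sub_le _ _).trans ?_
  linarith [(norm_pure (a (t + 1) i)).le, norm_empirical_le a t i]

end Empirical

theorem IsWeightMatrix.sum_neighbors_smul {N Y : Type*} [Fintype N] [DecidableEq N]
    {G : SimpleGraph N} [DecidableRel G.Adj] {W : Matrix N N ℝ} (hW : IsWeightMatrix G W) (i : N)
    (f : N → EuclideanSpace ℝ Y) :
    ∑ j ∈ insert i (G.neighborFinset i), W i j • f j = ∑ j, W i j • f j := by
  refine Finset.sum_subset (Finset.subset_univ _) fun j _ hj => ?_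
  simp only [Finset.mem_insert, SimpleGraph.mem_neighborFinset, not_or] at hj
  rw [hW.sparsity i j (Ne.symm hj.1) hj.2, zero_smul]

/-! ### Tracking and convergence of the centroid -/

section Dynamics
variable {N Y : Type*} [Fintype N] [DecidableEq N] [Fintype Y] [DecidableEq Y]
  {u : N → (N → Y) → ℝ} {G : SimpleGraph N} [DecidableRel G.Adj] {W : Matrix N N ℝ}
  {a : ℕ → N → Y} {qhat : ℕ → N → EuclideanSpace ℝ Y}

/-- The estimates of the centroid have error of order `1 / t`. -/
theorem IsDistributedECFP.exists_norm_sub_centroid_le [Nonempty N] (hW : IsWeightMatrix G W)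
    (h : IsDistributedECFP u G W a qhat) :
    ∃ B, ∀ (t : ℕ) (i : N), ‖qhat (t + 1) i - centroid a (t + 1)‖ ≤ B / (t + 1) := by
  obtain ⟨k, hk, hpos⟩ := hW.irreducible.exists_pow_pos_of_aperiodic hW.aperiodic
  refine Matrix.exists_norm_sub_average_le hW.doublyStochastic hk hpos
    (z := fun t => qhat (t + 1)) (r := fun t => empirical a (t + 1)) (D := 2)
    (fun i => ?_) (fun t i => ?_) fun t i => ?_
  · simpa only [zero_add, hW.sum_neighbors_smul] using h.init i
  · rw [h.update (t + 1) (by omega) i, hW.sum_neighbors_smul]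
  · refine (norm_empirical_succ_sub_le a (t + 1) i).trans ?_
    push_cast
    gcongr
    linarith

/-- The empirical centroid approaches the stationary points of the diagonal utility. -/
theorem IsDistributedECFP.exists_stationary_seq (hu : IsIdenticalPermInvariant u)
    (hW : IsWeightMatrix G W) (h : IsDistributedECFP u G W a qhat) (i₀ : N) :
    ∃ z : ℕ → EuclideanSpace ℝ Y,
      (∀ t, z t ∈ stationaryPoints (diagonalUtility u i₀) (simplex Y)) ∧
      Tendsto (fun t => centroid a t - z t) atTop (𝓝 0) := by
  have : Nonempty N := ⟨i₀⟩
  obtain ⟨B, hB⟩ := h.exists_norm_sub_centroid_le hW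
  have hB0 : 0 ≤ B := by simpa using (norm_nonneg _).trans (hB 0 i₀)
  have hns : ¬ Summable fun t : ℕ => ((t : ℝ) + 2)⁻¹ := by
    have := (summable_nat_add_iff 2).not.2 Real.not_summable_natCast_inv
    simpa using this
  have hs2 : Summable fun t : ℕ => ((t : ℝ) + 2)⁻¹ ^ 2 := by
    have := (summable_nat_add_iff 2).2 (Real.summable_nat_pow_inv.2 (show 1 < 2 by norm_num))
    simpa using this
  -- Time is shifted by one, so the step size is `1 / (t + 2)`; `c = 2 * B` because `1 / (t + 1) ≤ 2
  -- / (t + 2)`.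
  obtain ⟨z, hz, hzt⟩ := exists_stationary_seq_of_average isCompact_simplex convex_simplex
    (contDiff_diagonalUtility u i₀) (γ := fun t => ((t : ℝ) + 2)⁻¹) (fun t => by positivity)
    (fun t => inv_le_one_of_one_le₀ (by linarith [(Nat.cast_nonneg t : (0 : ℝ) ≤ t)])) hns hs2
    (x := fun t => centroid a (t + 1)) (β := fun t i => pure (a (t + 2) i))
    (q := fun t => qhat (t + 1)) (c := 2 * B)
    (fun t => centroid_mem_simplex a (by omega)) (fun t i => pure_mem_simplex _)
    (fun t => by
      rw [centroid_succ a (t + 1)]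
      push_cast
      norm_num [add_assoc])
    (fun t i g hg => le_of_pure_le (fun k => by
      rw [fderiv_diagonalUtility hu i₀ i, fderiv_diagonalUtility hu i₀ i]
      exact mul_le_mul_of_nonneg_left (h.bestResponse (t + 1) (by omega) i k) (by positivity)) hg)
    (fun t i => (hB t i).trans (by
      rw [← div_eq_mul_inv, div_le_div_iff₀ (by positivity) (by positivity)]
      nlinarith [mul_nonneg hB0 (Nat.cast_nonneg t : (0 : ℝ) ≤ t)]))
  -- This undoes the shift; at `t = 0` truncated subtraction gives `z 0`, still stationary.
  refine ⟨fun t => z (t - 1), fun t => hz _, ?_⟩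
  rw [← tendsto_add_atTop_iff_nat 1, tendsto_zero_iff_norm_tendsto_zero]
  simpa [dist_eq_norm] using hzt

end Dynamics

end ECFP

/-! ### The main theorem -/

theorem theorem2 {N Y : Type*} [Fintype N] [DecidableEq N] [Fintype Y] [DecidableEq Y]
    (u : N → (N → Y) → ℝ) (hu : ECFP.IsIdenticalPermInvariant u)
    (G : SimpleGraph N) [DecidableRel G.Adj] (hG : G.Connected)
    (W : Matrix N N ℝ) (hW : ECFP.IsWeightMatrix G W)
    (a : ℕ → N → Y) (qhat : ℕ → N → EuclideanSpace ℝ Y)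
    (h : ECFP.IsDistributedECFP u G W a qhat) :
    (ECFP.consensusEquilibria u).Nonempty ∧
    Tendsto (fun t => Metric.infDist (WithLp.toLp 2 (qhat t) : ECFP.Joint N Y)
      (ECFP.consensusEquilibria u)) atTop (𝓝 0) ∧
    (∀ i j, Tendsto (fun t => dist (qhat t i) (qhat t j)) atTop (𝓝 0)) ∧
    (∀ i, Tendsto (fun t => Metric.infDist (WithLp.toLp 2 (fun _ : N => qhat t i) : ECFP.Joint N Y)
      (ECFP.consensusEquilibria u)) atTop (𝓝 0)) ∧
    (∀ i, (fun t : ℕ => ‖qhat t i - ECFP.centroid a t‖) =O[atTop]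
      (fun t : ℕ => Real.log t / t)) := by
  obtain ⟨i₀⟩ : Nonempty N := hG.nonempty
  have : Nonempty N := ⟨i₀⟩
  obtain ⟨B, hB⟩ := h.exists_norm_sub_centroid_le hW
  have hB' : ∀ i, ∀ t : ℕ, 1 ≤ t → ‖qhat t i - ECFP.centroid a t‖ ≤ B / t := fun i t ht => by
    obtain ⟨s, rfl⟩ := Nat.exists_eq_add_of_le' ht
    exact_mod_cast hB s i
  have htrack : ∀ i, Tendsto (fun t => qhat t i - ECFP.centroid a t) atTop (𝓝 0) := fun i =>
    squeeze_zero_norm' (eventually_atTop.2 ⟨1, hB' i⟩) (tendsto_const_div_atTop_nhds_zero_nat B)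
  obtain ⟨z, hz, hzt⟩ := h.exists_stationary_seq hu hW i₀
  have hqz : ∀ i, Tendsto (fun t => qhat t i - z t) atTop (𝓝 0) := fun i => by
    simpa using (htrack i).add hzt
  refine ⟨⟨_, ECFP.toLp_const_mem_consensusEquilibria hu i₀ (hz 0)⟩,
    ECFP.tendsto_infDist_consensusEquilibria hu i₀ hz hqz, fun i j => ?_,
    fun i => ECFP.tendsto_infDist_consensusEquilibria hu i₀ hz fun _ => hqz i, fun i => ?_⟩
  · simpa [dist_eq_norm] using ((htrack i).sub (htrack j)).norm
  · refine Asymptotics.IsBigO.of_bound |B| ?_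
    -- The error is in fact `O(1 / t)`; from `3 > e` on, `log t ≥ 1`.
    filter_upwards [eventually_ge_atTop 3] with t ht
    have h3 : (3 : ℝ) ≤ t := by exact_mod_cast ht
    have hlog : 1 ≤ Real.log t := by
      rw [Real.le_log_iff_exp_le (by linarith)]
      linarith [Real.exp_one_lt_d9]
    rw [norm_norm, Real.norm_of_nonneg (by positivity), ← mul_div_assoc]
    refine (hB' i t (by omega)).trans ?_
    gcongr
    nlinarith [le_abs_self B, abs_nonneg B]
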